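/- Let $I$ be a non-empty finite set and let $A=(a_{ij})_{i,j\in I}$ be an E-generalized Cartan matrix, i.e. a real matrix with $a_{ii}=2$ for all $i$, $a_{ij}\le 0$ for $i\ne j$, $a_{ij}\neq 0\Rightarrow a_{ji}\ne 0$, and such that for $i\neq j$ either $a_{ij}a_{ji}\ge 4$ or $a_{ij}a_{ji}=4\cos^2(\pi/k_{ij})$ for some integer $k_{ij}\ge 2$. For $i\ne j$ put $m_{ij}=k_{ij}$ in the second case and $m_{ij}=\infty$ in the first. Let $W$ be the Coxeter group with generators $s_i$ $(i\in I)$ and relations $s_i^2=1$ and $(s_is_j)^{m_{ij}}=1$ for $i\ne j$ with $m_{ij}<\infty$. Let $V$ be the real vector space with basis $(\alpha_i)_{i\in I}$ and let $B$ be the bilinear form with $B(\alpha_i,\alpha_j)=\frac12a_{ij}$; the group $W$ acts linearly on $V$ by $s_i.v=v-2B(\alpha_i,v)\alpha_i$. Let $\Phi=\{w.\alpha_i : w\in W,\ i\in I\}$, let $\Phi^+$ be the set of those elements of $\Phi$ all of whose coordinates with respect to $(\alpha_i)$ are nonnegative, and for $\alpha\in\Phi$ let $\mathfrak S(\alpha)=\{K\alpha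 : K\in\mathbb R\}\cap\Phi^+$. Let $\Gamma$ be the graph with nodes $\gamma_i$ $(i\in I)$ and an edge between $\gamma_i$ and $\gamma_j$ if and only if $i\ne j$ and $a_{ij},a_{ji}\ne0$. Distinct nodes $\gamma_i,\gamma_j$ are odd neighbors if $m_{ij}$ is finite and odd; in this case put $K_{ji}=\dfrac{-a_{ji}}{2\cos(\pi/m_{ij})}$. An ON-path is a sequence $\mathcal P=[\gamma_{i_0},\dots,\gamma_{i_p}]$ with $p\ge 0$ in which consecutive nodes are odd neighbors; it has start node $\gamma_{i_0}$ and end node $\gamma_{i_p}$, and $\Pi_{\mathcal P}=K_{i_pi_{p-1}}\cdots K_{i_2i_1}K_{i_1i_0}$ (which is $1$ if $p=0$). It is an ON-cycle if $\gamma_{i_0}=\gamma_{i_p}$, and it is simple if it has no repeated nodes, except that its start and end nodes may coincide. ON-paths $\mathcal P,\mathcal Q$ are scalar-distinct if $\Pi_{\mathcal P}\ne\Pi_{\mathcal Q}$. An ON-connected component $(\Gamma',A')$ of $(\Gamma,A)$ is given by a maximal set of nodes which can be pairwise joined by ON-paths, together with the corresponding subgraph of $\Gamma$ and submatrix of $A$.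 It is unital ON-cyclic if $\Pi_{\mathcal C}=1$ for all ON-cycles $\mathcal C$ in $(\Gamma',A')$. **Theorem 3.6.** Let $(\Gamma',A')$ be an ON-connected component of $(\Gamma,A)$, and let $J=\{x\in I : \gamma_x\in\Gamma'\}$. The following are equivalent: 1. $(\Gamma',A')$ is unital ON-cyclic. 2. $|\mathfrak S(w.\alpha_x)|<\infty$ for some $x\in J$ and $w\in W$. 3. $|\mathfrak S(w.\alpha_x)|<\infty$ for all $x\in J$ and $w\in W$. In these cases, for all $x,y\in J$ and $w\in W$ we have $|\mathfrak S(\alpha_x)|=|\mathfrak S(w.\alpha_y)|$, and this common quantity is equal to the largest number of pairwise scalar-distinct simple ON-paths in $(\Gamma,A)$ with end node $\gamma_x$. -/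

import Mathlib

/-- An E-generalized Cartan matrix with (finite) index set `ι`. -/
structure EGCM (ι : Type*) where
  /-- The underlying real matrix `(a i j)`. -/
  a : Matrix ι ι ℝ
  diag : ∀ i, a i i = 2
  nonpos : ∀ i j, i ≠ j → a i j ≤ 0
  ne_zero : ∀ i j, a i j ≠ 0 → a j i ≠ 0
  prod_entries : ∀ i j, i ≠ j →
    4 ≤ a i j * a j i ∨ ∃ k : ℕ, 2 ≤ k ∧ a i j * a j i = 4 * Real.cos (Real.pi / k) ^ 2

namespace EGCM

noncomputable section

variable {ι : Type*}

/-- The exponent `m i j` for `i ≠ j`: the integer `k ≥ 2` with `a i j * a j i = 4 cos² (π / k)`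
if there is one (it is then unique), and `0`, which encodes `∞` as in Mathlib's Coxeter matrices,
if there is none. -/
def m (A : EGCM ι) (i j : ι) : ℕ :=
  sInf {k : ℕ | 2 ≤ k ∧ A.a i j * A.a j i = 4 * Real.cos (Real.pi / k) ^ 2}

theorem m_symm (A : EGCM ι) (i j : ι) : A.m i j = A.m j i := by
  simp only [m, mul_comm (A.a i j)]

theorem m_spec (A : EGCM ι) (i j : ι) (h : A.m i j ≠ 0) :
    2 ≤ A.m i j ∧ A.a i j * A.a j i = 4 * Real.cos (Real.pi / A.m i j) ^ 2 := by
  have hne : {k : ℕ | 2 ≤ k ∧ A.a i j * A.a j i = 4 * Real.cos (Real.pi / k) ^ 2}.Nonempty := by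
    by_contra hc
    rw [Set.not_nonempty_iff_eq_empty] at hc
    exact h (by rw [m, hc, Nat.sInf_empty])
  exact Nat.sInf_mem hne

/-- The Coxeter matrix of an E-GCM. -/
def coxeterMatrix [DecidableEq ι] (A : EGCM ι) : CoxeterMatrix ι where
  M := Matrix.of fun i j => if i = j then 1 else A.m i j
  isSymm := Matrix.IsSymm.ext fun i j => by
    simp only [Matrix.of_apply, eq_comm (a := j), A.m_symm j i]
  diagonal := fun i => if_pos rfl
  off_diagonal := fun i j hij => by
    rw [Matrix.of_apply, if_neg hij]
    intro h1
    have h2 := (A.m_spec i j (by omega)).1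
    omega

/-- The Coxeter group `W` of an E-GCM, with generators `A.coxeterMatrix.simple i`. -/
abbrev W [DecidableEq ι] (A : EGCM ι) : Type _ := A.coxeterMatrix.Group

/-- The simple roots: the standard basis of `V = ι → ℝ`. -/
def simpleRoot [DecidableEq ι] (_A : EGCM ι) (i : ι) : ι → ℝ := Pi.single i 1

/-- The bilinear form on `V` with `B (αᵢ, αⱼ) = a i j / 2`. -/
def form [Fintype ι] [DecidableEq ι] (A : EGCM ι) : LinearMap.BilinForm ℝ (ι → ℝ) :=
  Matrix.toBilin' ((1 / 2 : ℝ) • A.a)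

theorem form_simpleRoot [Fintype ι] [DecidableEq ι] (A : EGCM ι) (i j : ι) :
    A.form (A.simpleRoot i) (A.simpleRoot j) = A.a i j / 2 := by
  simp only [form, simpleRoot, Matrix.toBilin'_single, Matrix.smul_apply, smul_eq_mul]
  ring

theorem two_form_simpleRoot [Fintype ι] [DecidableEq ι] (A : EGCM ι) (i j : ι) :
    ((2 : ℝ) • A.form (A.simpleRoot i)) (A.simpleRoot j) = A.a i j := by
  rw [LinearMap.smul_apply, form_simpleRoot, smul_eq_mul]
  ring

/-- The operator `S i : V → V`, given by `v ↦ v - 2 B (αᵢ, v) αᵢ`. -/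
def S [Fintype ι] [DecidableEq ι] (A : EGCM ι) (i : ι) : (ι → ℝ) ≃ₗ[ℝ] (ι → ℝ) :=
  Module.reflection (f := (2 : ℝ) • A.form (A.simpleRoot i)) (x := A.simpleRoot i)
    ((A.two_form_simpleRoot i i).trans (A.diag i))

theorem S_apply [Fintype ι] [DecidableEq ι] (A : EGCM ι) (i : ι) (v : ι → ℝ) :
    A.S i v = v - (2 * A.form (A.simpleRoot i) v) • A.simpleRoot i := by
  simp [S, Module.reflection_apply]

/-- The operators `S i` satisfy the Coxeter relations. -/
theorem isLiftable_S [Fintype ι] [DecidableEq ι] (A : EGCM ι) :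
    A.coxeterMatrix.IsLiftable A.S := by
  intro i j
  by_cases hij : i = j
  · subst hij
    rw [A.coxeterMatrix.diagonal, pow_one]
    ext1 v
    simp [S, Module.involutive_reflection _ v]
  have hM : A.coxeterMatrix i j = A.m i j := if_neg hij
  rw [hM]
  by_cases h0 : A.m i j = 0
  · rw [h0, pow_zero]
  obtain ⟨h2, hprod⟩ := A.m_spec i j h0
  set n := A.m i j with hn
  have key : ∀ v, ((A.S i * A.S j) ^ n) v = v := by
    intro v
    have hx : ((2 : ℝ) • A.form (A.simpleRoot j)) (A.simpleRoot i) = A.a j i :=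
      A.two_form_simpleRoot j i
    have hy : ((2 : ℝ) • A.form (A.simpleRoot i)) (A.simpleRoot j) = A.a i j :=
      A.two_form_simpleRoot i j
    set φ : ℝ := 2 * (Real.pi / n) with hφ
    have hnpos : (0 : ℝ) < n := by exact_mod_cast (by omega : 0 < n)
    have hnφ : n * φ = 2 * Real.pi := by rw [hφ]; field_simp
    have ht : 2 * Real.cos φ = A.a i j * A.a j i - 2 := by
      rw [hprod, hφ, Real.cos_two_mul]; ring
    have hrefl := Module.reflection_mul_reflection_pow_apply
      ((A.two_form_simpleRoot i i).trans (A.diag i))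
      ((A.two_form_simpleRoot j j).trans (A.diag j)) n v (2 * Real.cos φ)
      (by rw [hx, hy, ht])
    refine hrefl.trans ?_
    rw [hx, hy]
    rcases Nat.lt_or_ge 2 n with h3 | h3
    · have hn3 : (3 : ℝ) ≤ n := by exact_mod_cast h3
      have hsin : Real.sin φ ≠ 0 := by
        apply ne_of_gt
        apply Real.sin_pos_of_pos_of_lt_pi
        · rw [hφ]; positivity
        · have := Real.pi_pos
          nlinarith
      have hcheb := fun k : ℤ => Polynomial.Chebyshev.S_two_mul_real_cos φ k
      rcases Nat.even_or_odd' n with ⟨k, hk | hk⟩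
      · have e1 : ((n : ℤ) - 2) / 2 = (k : ℤ) - 1 := by omega
        have e2 : ((n : ℤ) - 1) / 2 = (k : ℤ) - 1 := by omega
        have hz : (Polynomial.Chebyshev.S ℝ ((k : ℤ) - 1)).eval (2 * Real.cos φ) = 0 := by
          have h := hcheb ((k : ℤ) - 1)
          have : ((((k : ℤ) - 1 : ℤ) : ℝ) + 1) * φ = Real.pi := by
            push_cast
            have : (n : ℝ) = 2 * k := by exact_mod_cast hk
            rw [this] at hnφ
            linarith
          rw [this, Real.sin_pi] at h
          exact (mul_eq_zero.mp h).resolve_right hsin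
        rw [e1, e2, hz]
        simp
      · have e1 : ((n : ℤ) - 2) / 2 = (k : ℤ) - 1 := by omega
        have e2 : ((n : ℤ) - 1) / 2 = (k : ℤ) := by omega
        have e3 : ((n : ℤ) - 3) / 2 = (k : ℤ) - 1 := by omega
        have e4 : (n : ℤ) / 2 = (k : ℤ) := by omega
        have hz : (Polynomial.Chebyshev.S ℝ (k : ℤ)).eval (2 * Real.cos φ) +
            (Polynomial.Chebyshev.S ℝ ((k : ℤ) - 1)).eval (2 * Real.cos φ) = 0 := by
          have ha := hcheb (k : ℤ)
          have hb := hcheb ((k : ℤ) - 1)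
          have : ((k : ℤ) + 1 : ℝ) * φ = 2 * Real.pi - ((((k : ℤ) - 1 : ℤ) : ℝ) + 1) * φ := by
            push_cast
            have : (n : ℝ) = 2 * k + 1 := by exact_mod_cast hk
            rw [this] at hnφ
            linarith
          rw [this, Real.sin_two_pi_sub] at ha
          have : ((Polynomial.Chebyshev.S ℝ (k : ℤ)).eval (2 * Real.cos φ) +
            (Polynomial.Chebyshev.S ℝ ((k : ℤ) - 1)).eval (2 * Real.cos φ)) * Real.sin φ = 0 := by
            rw [add_mul, ha, hb]; ring
          exact (mul_eq_zero.mp this).resolve_right hsin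
        rw [e1, e2, e3, e4, hz]
        simp
    · have hn2 : n = 2 := by omega
      have hcos : 2 * Real.cos φ = -2 := by
        rw [hφ, hn2]
        have : 2 * (Real.pi / ((2 : ℕ) : ℝ)) = Real.pi := by push_cast; ring
        rw [this, Real.cos_pi]; norm_num
      have hp0 : A.a i j * A.a j i = 0 := by linarith
      have hij0 : A.a i j = 0 := by
        by_contra h
        exact mul_ne_zero h (A.ne_zero i j h) hp0
      have hji0 : A.a j i = 0 := by
        by_contra h
        exact A.ne_zero j i h hij0
      rw [hij0, hji0, hcos, hn2]
      norm_num
      module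
  exact LinearEquiv.ext key

/-- The geometric representation `σ : W → GL(V)`, with `σ (sᵢ) = S i`. -/
def σ [Fintype ι] [DecidableEq ι] (A : EGCM ι) : A.W →* ((ι → ℝ) ≃ₗ[ℝ] (ι → ℝ)) :=
  A.coxeterMatrix.toCoxeterSystem.lift ⟨A.S, A.isLiftable_S⟩

theorem σ_simple [Fintype ι] [DecidableEq ι] (A : EGCM ι) (i : ι) :
    A.σ (A.coxeterMatrix.simple i) = A.S i :=
  A.coxeterMatrix.toCoxeterSystem.lift_apply_simple A.isLiftable_S i

/-- The root system `Φ`. -/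
def roots [Fintype ι] [DecidableEq ι] (A : EGCM ι) : Set (ι → ℝ) :=
  {v | ∃ (w : A.W) (i : ι), v = A.σ w (A.simpleRoot i)}

/-- The positive roots: those with nonnegative coordinates in the basis of simple roots. -/
def posRoots [Fintype ι] [DecidableEq ι] (A : EGCM ι) : Set (ι → ℝ) :=
  {v | v ∈ A.roots ∧ ∀ i, 0 ≤ v i}

/-- The set `𝔖(α)` of all positive roots that are real multiples of `α`. -/
def multiples [Fintype ι] [DecidableEq ι] (A : EGCM ι) (α : ι → ℝ) : Set (ι → ℝ) :=
  {v | ∃ K : ℝ, v = K • α} ∩ A.posRoots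

/-- The graph of odd neighbors on the nodes. Its walks are the ON-paths. -/
def oddGraph (A : EGCM ι) : SimpleGraph ι where
  Adj i j := i ≠ j ∧ Odd (A.m i j)
  symm := ⟨fun i j h => ⟨h.1.symm, A.m_symm i j ▸ h.2⟩⟩
  loopless := ⟨fun _ h => h.1 rfl⟩

/-- The number `K j i = -a j i / (2 cos (π / m i j))`, for odd neighbors `i` and `j`. -/
def K (A : EGCM ι) (j i : ι) : ℝ := -A.a j i / (2 * Real.cos (Real.pi / A.m i j))

/-- ON-paths from `x` to `y`: sequences of nodes in which consecutive nodes are odd neighbors. -/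
abbrev ONPath (A : EGCM ι) (x y : ι) : Type _ := A.oddGraph.Walk x y

/-- The scalar `Π_P` of an ON-path `P`, the product of the `K (i_{r+1}) (i_r)` along `P`. -/
def scalar (A : EGCM ι) : {x y : ι} → A.ONPath x y → ℝ
  | _, _, .nil => 1
  | _, _, .cons (u := i) (v := j) _ P => A.scalar P * A.K j i

/-- An ON-path is simple if it has no repeated nodes, except that its start node and its end node
may coincide. -/
def IsSimple (A : EGCM ι) {x y : ι} (P : A.ONPath x y) : Prop :=
  ∀ r s : ℕ, r < s → s ≤ P.length → P.getVert r = P.getVert s → r = 0 ∧ s = P.length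

/-- Every ON-cycle has scalar `1`. -/
def UnitalONCyclic (A : EGCM ι) : Prop := ∀ (x : ι) (C : A.ONPath x x), A.scalar C = 1

/-- The E-GCM of the subgraph on the nodes in `J`. -/
def restrict (A : EGCM ι) (J : Set ι) : EGCM J where
  a := fun i j => A.a i j
  diag i := A.diag i
  nonpos i j h := A.nonpos i j (fun e => h (Subtype.ext e))
  ne_zero i j h := A.ne_zero i j h
  prod_entries i j h := A.prod_entries i j (fun e => h (Subtype.ext e))

/-- `J` is the node set of an ON-connected component: a maximal set of nodes which can be pairwise
joined by ON-paths. -/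
def IsONComponent (A : EGCM ι) (J : Set ι) : Prop :=
  Maximal (fun T : Set ι => ∀ x ∈ T, ∀ y ∈ T, Nonempty (A.ONPath x y)) J

/-- There are `N` pairwise scalar-distinct simple ON-paths with end node `x`. -/
def HasScalarDistinctPaths (A : EGCM ι) (x : ι) (N : ℕ) : Prop :=
  ∃ F : Finset (Σ z : ι, A.ONPath z x), F.card = N ∧ (∀ P ∈ F, A.IsSimple P.2) ∧
    ∀ P ∈ F, ∀ Q ∈ F, P ≠ Q → A.scalar P.2 ≠ A.scalar Q.2

end

end EGCM

/-! The key fact is that, for `K > 0`, the vector `K • αₓ` is a root if and only if `K` is the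
scalar of an ON-path ending at `x`. Since `W` permutes roots, and `w` maps `αₓ` to a vector with
coordinates of one sign, `𝔖(w.αₓ)` has as many elements as the set `pathScalars` of these scalars
(`encard_multiples`).

That path scalars give roots is a dihedral computation: for odd neighbors `i`, `j` the alternating
word of length `m i j - 1` sends `αᵢ` to `K j i • αⱼ`, and such words compose along a path. For the
converse, split off from `w` its part in the subgroup generated by `i` and a right descent `j`. By
`σ_alternatingWord_cases` this part fixes `αᵢ`, moves it along an edge of the odd graph, or sends it
to a strictly positive combination of `αᵢ` and `αⱼ`. The last case cannot lead to a multiple of a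
simple root, so induction on length yields an ON-path.

What remains concerns scalars only. Changing the end node within a component rescales the whole set.
If all cycles have scalar `1`, a scalar depends only on the endpoints, so the set is finite and
simple paths realize it. A cycle with scalar different from `1` produces infinitely many scalars
through its powers. -/

namespace CoxeterSystem

/-! ### Rank two coset decompositions in a Coxeter group. -/

variable {B W : Type*} [Group W] {M : CoxeterMatrix B} (cs : CoxeterSystem M W)

/-- Every `w` without right descent `i` is the product of an element without right descents `i` and
`j` and of an alternating word in `i` and `j` that ends in `j`, and the lengths add up. -/
theorem exists_eq_mul_alternatingWord (w : W) (i j : B) (hi : ¬ cs.IsRightDescent w i) :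
    ∃ (u : W) (k : ℕ), w = u * cs.wordProd (alternatingWord i j k) ∧
      cs.length u + k = cs.length w ∧ ¬ cs.IsRightDescent u i ∧ ¬ cs.IsRightDescent u j ∧
      (cs.IsRightDescent w j → 0 < k) := by
  induction hn : cs.length w using Nat.strong_induction_on generalizing w i j with
  | _ n ih =>
    by_cases hj : cs.IsRightDescent w j
    · have hl := cs.isRightDescent_iff.mp hj
      -- Once `j` is stripped off it is no longer a descent, so the induction applies with `i` and
      -- `j` exchanged.
      obtain ⟨u, k, hw, hk, h1, h2, -⟩ := ih (cs.length (w * cs.simple j)) (by omega)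
        (w * cs.simple j) j i (cs.isRightDescent_iff_not_isRightDescent_mul.mp hj) rfl
      refine ⟨u, k + 1, ?_, by omega, h2, h1, fun _ => k.succ_pos⟩
      rw [alternatingWord_succ, List.concat_eq_append, cs.wordProd_append, ← mul_assoc, ← hw]
      simp
    · exact ⟨w, 0, by simp [alternatingWord], by omega, hi, hj, fun h => absurd h hj⟩

/-- At `k = M i j` the braid relation rewrites the word so that it ends in `i`, which then cancels.
Each further letter on the left adds at most one to the length. -/
theorem length_alternatingWord_mul_simple_lt (i j : B) (hM : M i j ≠ 0) {k : ℕ}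
    (hk : M i j ≤ k) :
    cs.length (cs.wordProd (alternatingWord i j k) * cs.simple i) < k := by
  induction k, hk using Nat.le_induction with
  | base =>
    have h := cs.wordProd_braidWord_eq i j
    rw [braidWord, braidWord, M.symmetric j i] at h
    rw [h]
    obtain ⟨m, hm⟩ := Nat.exists_eq_succ_of_ne_zero hM
    rw [hm, Nat.succ_eq_add_one, alternatingWord_succ, List.concat_eq_append,
      cs.wordProd_append]
    have := cs.length_wordProd_le (alternatingWord i j m)
    rw [length_alternatingWord] at this
    simpa using Nat.lt_succ_of_le this
  | succ k hk ih =>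
    rw [alternatingWord_succ', cs.wordProd_cons, mul_assoc]
    have := cs.length_mul_le (cs.simple (if Even k then j else i))
      (cs.wordProd (alternatingWord i j k) * cs.simple i)
    rw [cs.length_simple] at this
    omega

theorem lt_of_not_isRightDescent_mul_alternatingWord {u w : W} {i j : B} {k : ℕ}
    (hw : w = u * cs.wordProd (alternatingWord i j k)) (hk : cs.length u + k = cs.length w)
    (hi : ¬ cs.IsRightDescent w i) (hM : M i j ≠ 0) : k < M i j := by
  by_contra h
  have h1 := cs.length_alternatingWord_mul_simple_lt i j hM (not_lt.mp h)
  have h2 := cs.length_mul_le u (cs.wordProd (alternatingWord i j k) * cs.simple i)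
  rw [← mul_assoc, ← hw] at h2
  exact hi (by rw [IsRightDescent]; omega)

end CoxeterSystem

/-! ### Signs and special values of the dihedral coefficients. -/

/-- The coefficients `g` with `g 0 = 0`, `g 1 = 1` and `g (k + 2) = s * g (k + 1) - g k`, which
describe the orbits of a dihedral group on its roots. -/
def dihedralCoeff (s : ℝ) : ℕ → ℝ
  | 0 => 0
  | 1 => 1
  | k + 2 => s * dihedralCoeff s (k + 1) - dihedralCoeff s k

theorem dihedralCoeff_pos_of_two_le {s : ℝ} (hs : 2 ≤ s) (k : ℕ) :
    0 < dihedralCoeff s (k + 1) := by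
  -- For `s ≥ 2` the recursion makes the increments nondecreasing, so the sequence increases.
  suffices h : 0 ≤ dihedralCoeff s k ∧ dihedralCoeff s k < dihedralCoeff s (k + 1) from
    h.1.trans_lt h.2
  induction k with
  | zero => simp [dihedralCoeff]
  | succ k ih =>
    refine ⟨(ih.1.trans_lt ih.2).le, ?_⟩
    rw [dihedralCoeff]
    nlinarith [ih.1, ih.2]

theorem dihedralCoeff_mul_sin (θ : ℝ) (k : ℕ) :
    dihedralCoeff (2 * Real.cos θ) k * Real.sin θ = Real.sin (k * θ) := by
  induction k using Nat.twoStepInduction with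
  | zero => simp [dihedralCoeff]
  | one => simp [dihedralCoeff]
  | more k h0 h1 =>
    rw [dihedralCoeff, sub_mul, mul_assoc, h1, h0]
    have e1 : ((k + 1 : ℕ) : ℝ) * θ = k * θ + θ := by push_cast; ring
    have e2 : ((k + 2 : ℕ) : ℝ) * θ = k * θ + θ + θ := by push_cast; ring
    rw [e1, e2, Real.sin_add (k * θ + θ), Real.cos_add, Real.sin_add]
    linear_combination (Real.sin (k * θ)) * (Real.sin_sq_add_cos_sq θ)

section Finite

variable {m : ℕ}

theorem sin_pi_div_pos (hm : 2 ≤ m) : 0 < Real.sin (Real.pi / m) := by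
  have h2 : (2 : ℝ) ≤ m := by exact_mod_cast hm
  refine Real.sin_pos_of_pos_of_lt_pi (by positivity) ?_
  rw [div_lt_iff₀ (by linarith)]
  nlinarith [Real.pi_pos]

theorem dihedralCoeff_pos (hm : 2 ≤ m) {k : ℕ} (h0 : 0 < k) (hk : k < m) :
    0 < dihedralCoeff (2 * Real.cos (Real.pi / m)) k := by
  have h := dihedralCoeff_mul_sin (Real.pi / m) k
  refine pos_of_mul_pos_left (b := Real.sin (Real.pi / m)) ?_ (sin_pi_div_pos hm).le
  have hm' : (0 : ℝ) < m := by exact_mod_cast (by omega : 0 < m)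
  have hk' : (k : ℝ) < m := by exact_mod_cast hk
  have hk0 : (0 : ℝ) < k := by exact_mod_cast h0
  rw [h]
  refine Real.sin_pos_of_pos_of_lt_pi (by positivity) ?_
  rw [mul_div_assoc', div_lt_iff₀ hm']
  nlinarith [Real.pi_pos]

theorem dihedralCoeff_self (hm : 2 ≤ m) :
    dihedralCoeff (2 * Real.cos (Real.pi / m)) m = 0 := by
  have h := dihedralCoeff_mul_sin (Real.pi / m) m
  have hm' : (m : ℝ) ≠ 0 := by exact_mod_cast (by omega : m ≠ 0)
  rw [mul_div_cancel₀ _ hm', Real.sin_pi] at h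
  exact (mul_eq_zero.mp h).resolve_right (sin_pi_div_pos hm).ne'

theorem dihedralCoeff_pred {k : ℕ} (hk : 1 ≤ k) :
    dihedralCoeff (2 * Real.cos (Real.pi / (k + 1 : ℕ))) k = 1 := by
  have h := dihedralCoeff_mul_sin (Real.pi / (k + 1 : ℕ)) k
  have hm' : ((k + 1 : ℕ) : ℝ) ≠ 0 := by exact_mod_cast (by omega : k + 1 ≠ 0)
  have e : (k : ℝ) * (Real.pi / (k + 1 : ℕ)) = Real.pi - Real.pi / (k + 1 : ℕ) := by
    field_simp
    push_cast
    ring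
  rw [e, Real.sin_pi_sub] at h
  exact mul_right_cancel₀ (sin_pi_div_pos (by omega)).ne' (h.trans (one_mul _).symm)

theorem cos_pi_div_pos (hm : 3 ≤ m) : 0 < Real.cos (Real.pi / m) := by
  have h2 : (3 : ℝ) ≤ m := by exact_mod_cast hm
  have := Real.pi_pos
  refine Real.cos_pos_of_mem_Ioo ⟨(neg_lt_zero.mpr (by positivity)).trans (by positivity), ?_⟩
  rw [div_lt_iff₀ (by linarith)]
  nlinarith

end Finite

/-! ### Scalars of ON-paths under concatenation and reversal. -/

namespace EGCM

variable {ι : Type*} (A : EGCM ι)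

theorem a_neg {i j : ι} (hij : i ≠ j) (h : A.a i j * A.a j i ≠ 0) : A.a j i < 0 :=
  lt_of_le_of_ne (A.nonpos j i hij.symm) (right_ne_zero_of_mul h)

theorem m_spec_of_exists {i j : ι}
    (h : ∃ k : ℕ, 2 ≤ k ∧ A.a i j * A.a j i = 4 * Real.cos (Real.pi / k) ^ 2) :
    2 ≤ A.m i j ∧ A.a i j * A.a j i = 4 * Real.cos (Real.pi / A.m i j) ^ 2 :=
  Nat.sInf_mem h

theorem m_eq_two {i j : ι} (h : A.a i j * A.a j i = 0) : A.m i j = 2 := by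
  have h2 : 2 ≤ 2 ∧ A.a i j * A.a j i = 4 * Real.cos (Real.pi / (2 : ℕ)) ^ 2 := by simp [h]
  exact le_antisymm (Nat.sInf_le h2) (A.m_spec_of_exists ⟨2, h2⟩).1

theorem m_of_odd {i j : ι} (h : Odd (A.m i j)) :
    3 ≤ A.m i j ∧ A.a i j * A.a j i = 4 * Real.cos (Real.pi / A.m i j) ^ 2 := by
  obtain ⟨h2, h3⟩ := A.m_spec i j h.pos.ne'
  refine ⟨?_, h3⟩
  rcases h with ⟨k, hk⟩
  omega

theorem K_pos {i j : ι} (h : A.oddGraph.Adj i j) : 0 < A.K j i := by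
  obtain ⟨h3, h4⟩ := A.m_of_odd h.2
  have hc := cos_pi_div_pos h3
  have := A.a_neg h.1 (by rw [h4]; positivity)
  exact div_pos (by linarith) (by linarith)

theorem scalar_pos {x y : ι} (P : A.ONPath x y) : 0 < A.scalar P := by
  induction P with
  | nil => exact one_pos
  | cons h P ih => exact mul_pos ih (A.K_pos h)

theorem K_mul_K {i j : ι} (h : A.oddGraph.Adj i j) : A.K i j * A.K j i = 1 := by
  obtain ⟨h3, h4⟩ := A.m_of_odd h.2
  have hc := cos_pi_div_pos h3
  rw [K, K, A.m_symm j i]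
  field_simp
  linarith

theorem scalar_append {x y z : ι} (P : A.ONPath x y) (Q : A.ONPath y z) :
    A.scalar (P.append Q) = A.scalar Q * A.scalar P := by
  induction P with
  | nil => simp [scalar]
  | cons h P ih => simp only [SimpleGraph.Walk.cons_append, scalar, ih, mul_assoc]

theorem scalar_reverse {x y : ι} (P : A.ONPath x y) :
    A.scalar P.reverse * A.scalar P = 1 := by
  induction P with
  | nil => simp [scalar]
  | @cons i j _ h P ih =>
    rw [SimpleGraph.Walk.reverse_cons, scalar_append]
    simp only [scalar, one_mul]
    linear_combination A.K_mul_K h + A.K i j * A.K j i * ih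

variable [DecidableEq ι]

theorem coxeterMatrix_apply {i j : ι} (hij : i ≠ j) : A.coxeterMatrix i j = A.m i j := if_neg hij

/-- The Coxeter system of an E-GCM. -/
noncomputable abbrev coxeterSystem : CoxeterSystem A.coxeterMatrix A.W := A.coxeterMatrix.toCoxeterSystem

theorem simpleRoot_ne_zero (i : ι) : A.simpleRoot i ≠ 0 :=
  fun h => one_ne_zero (Pi.single_eq_zero_iff.mp h)

theorem eq_smul_simpleRoot {v : ι → ℝ} {x : ι} (h : ∀ l ≠ x, v l = 0) :
    v = v x • A.simpleRoot x := by
  ext l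
  by_cases hl : l = x
  · subst hl; simp [simpleRoot]
  · simp [simpleRoot, h l hl, hl]

/-! ### The action of rank two subgroups on simple roots. -/

section Fintype

variable [Fintype ι]

theorem S_simpleRoot (i j : ι) :
    A.S i (A.simpleRoot j) = A.simpleRoot j - A.a i j • A.simpleRoot i := by
  rw [S_apply, form_simpleRoot, mul_div_cancel₀ _ two_ne_zero]

theorem S_simpleRoot_self (i : ι) : A.S i (A.simpleRoot i) = -A.simpleRoot i := by
  rw [S_simpleRoot, A.diag]
  module

theorem σ_mul_apply (w w' : A.W) (v : ι → ℝ) : A.σ (w * w') v = A.σ w (A.σ w' v) := by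
  rw [map_mul]
  rfl

theorem σ_mul_simple_self (w : A.W) (i : ι) :
    A.σ (w * A.coxeterMatrix.simple i) (A.simpleRoot i) = -A.σ w (A.simpleRoot i) := by
  rw [σ_mul_apply, σ_simple, S_simpleRoot_self, map_neg]

/-- Replacing `αⱼ` by `(-a j i / s) • αⱼ` makes both off-diagonal entries equal to `-s`, so the
usual symmetric dihedral formulas apply. The parity of `k` tells which reflection acted last. -/
theorem σ_alternatingWord_simpleRoot (i j : ι) {s : ℝ} (hs0 : s ≠ 0)
    (hs : s * s = A.a i j * A.a j i) (k : ℕ) :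
    A.σ (A.coxeterSystem.wordProd (CoxeterSystem.alternatingWord i j k)) (A.simpleRoot i) =
      if Even k then
        dihedralCoeff s (k + 1) • A.simpleRoot i +
          (dihedralCoeff s k * (-A.a j i / s)) • A.simpleRoot j
      else
        dihedralCoeff s k • A.simpleRoot i +
          (dihedralCoeff s (k + 1) * (-A.a j i / s)) • A.simpleRoot j := by
  induction k with
  | zero => simp [CoxeterSystem.alternatingWord, dihedralCoeff]
  | succ k ih =>
    rw [CoxeterSystem.alternatingWord_succ', CoxeterSystem.wordProd_cons, σ_mul_apply, ih]
    have hg : dihedralCoeff s (k + 2) = s * dihedralCoeff s (k + 1) - dihedralCoeff s k := rfl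
    by_cases hk : Even k
    · have hk' : ¬ Even (k + 1) := by simpa [Nat.even_add_one] using hk
      rw [if_pos hk, if_pos hk, if_neg hk']
      have := A.σ_simple j
      rw [show A.coxeterSystem.simple j = A.coxeterMatrix.simple j from rfl, this, map_add, map_smul, map_smul,
        S_simpleRoot_self, S_simpleRoot, hg]
      have e : (-A.a j i / s) * s = -A.a j i := by field_simp
      match_scalars
      · ring
      · linear_combination (-dihedralCoeff s (k + 1)) * e
    · have hk' : Even (k + 1) := by simpa [Nat.even_add_one] using hk
      rw [if_neg hk, if_neg hk, if_pos hk']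
      have := A.σ_simple i
      rw [show A.coxeterSystem.simple i = A.coxeterMatrix.simple i from rfl, this, map_add, map_smul, map_smul,
        S_simpleRoot_self, S_simpleRoot, hg]
      have e : (-A.a j i / s) * (-A.a i j) = s := by
        field_simp
        linarith
      match_scalars
      · linear_combination dihedralCoeff s (k + 1) * e
      · ring

/-- For odd neighbors, the longest minimal coset representative maps `αᵢ` to `K j i • αⱼ`. -/
theorem σ_alternatingWord_of_adj {i j : ι} (h : A.oddGraph.Adj i j) :
    A.σ (A.coxeterSystem.wordProd (CoxeterSystem.alternatingWord i j (A.m i j - 1))) (A.simpleRoot i) =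
      A.K j i • A.simpleRoot j := by
  obtain ⟨h3, h4⟩ := A.m_of_odd h.2
  have hodd := h.2
  have hc := cos_pi_div_pos h3
  have hK : A.K j i = -A.a j i / (2 * Real.cos (Real.pi / A.m i j)) := rfl
  rw [A.σ_alternatingWord_simpleRoot i j (s := 2 * Real.cos (Real.pi / A.m i j)) (by positivity)
    (by rw [h4]; ring), ← hK]
  have h5 := dihedralCoeff_self (m := A.m i j) (by omega)
  obtain ⟨k, hk⟩ : ∃ k, A.m i j = k + 1 := ⟨A.m i j - 1, by omega⟩
  have h6 := dihedralCoeff_pred (k := k) (by omega)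
  rw [hk] at h5 hodd ⊢
  have hke : Even k := by
    have := Nat.odd_add_one.mp hodd
    simpa using this
  rw [Nat.add_sub_cancel, if_pos hke, h5, h6]
  simp

/-- The action of a minimal coset representative of a rank two parabolic subgroup on `αᵢ`. -/
theorem σ_alternatingWord_cases {i j : ι} (hij : i ≠ j) {k : ℕ} (h0 : 0 < k)
    (hk : A.m i j ≠ 0 → k < A.m i j) :
    let v := A.σ (A.coxeterSystem.wordProd (CoxeterSystem.alternatingWord i j k)) (A.simpleRoot i)
    v = A.simpleRoot i ∨ (A.oddGraph.Adj i j ∧ v = A.K j i • A.simpleRoot j) ∨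
      ∃ p q : ℝ, 0 < p ∧ 0 < q ∧ v = p • A.simpleRoot i + q • A.simpleRoot j := by
  intro v
  by_cases hp : A.a i j * A.a j i = 0
  -- Here the two reflections commute and `m i j = 2`, so the word is the single letter `j`, which
  -- fixes `αᵢ`.
  · left
    rw [A.m_eq_two hp] at hk
    have hk1 : k = 1 := by have := hk (by norm_num); omega
    have ha : A.a j i = 0 := by
      by_contra h
      exact mul_ne_zero (A.ne_zero j i h) h hp
    have := A.σ_simple j
    simp only [v, hk1, CoxeterSystem.alternatingWord, List.concat_eq_append, List.nil_append,
      CoxeterSystem.wordProd_singleton]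
    rw [show A.coxeterSystem.simple j = A.coxeterMatrix.simple j from rfl, this, S_simpleRoot, ha]
    simp
  have hneg := A.a_neg hij hp
  rcases A.prod_entries i j hij with h4 | hex
  · right; right
    have hs : 2 ≤ √(A.a i j * A.a j i) := Real.le_sqrt_of_sq_le (by linarith)
    have hv := A.σ_alternatingWord_simpleRoot i j (s := √(A.a i j * A.a j i)) (by positivity)
      (Real.mul_self_sqrt (by linarith)) k
    have g1 := dihedralCoeff_pos_of_two_le hs k
    have g2 := dihedralCoeff_pos_of_two_le hs (k - 1)
    rw [Nat.sub_add_cancel h0] at g2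
    have hb : 0 < -A.a j i / √(A.a i j * A.a j i) := div_pos (by linarith) (by linarith)
    split_ifs at hv
    · exact ⟨_, _, g1, mul_pos g2 hb, hv⟩
    · exact ⟨_, _, g2, mul_pos g1 hb, hv⟩
  · obtain ⟨h2, h4⟩ := A.m_spec_of_exists hex
    have hk := hk (by omega)
    have h3 : 3 ≤ A.m i j := by
      by_contra h
      have : A.m i j = 2 := by omega
      rw [this] at h4
      exact hp (by simp [h4])
    have hc := cos_pi_div_pos h3
    have hv := A.σ_alternatingWord_simpleRoot i j (s := 2 * Real.cos (Real.pi / A.m i j))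
      (by positivity) (by rw [h4]; ring) k
    have hb : 0 < -A.a j i / (2 * Real.cos (Real.pi / A.m i j)) :=
      div_pos (by linarith) (by linarith)
    have g2 := dihedralCoeff_pos h2 h0 hk
    -- Only at `k + 1 = m` does a coefficient vanish, and the other one is then `1` before
    -- rescaling. The surviving root is `αⱼ` for `m` odd and `αᵢ` for `m` even.
    by_cases hkm : k + 1 = A.m i j
    · by_cases hodd : Odd (A.m i j)
      · right; left
        refine ⟨⟨hij, hodd⟩, ?_⟩
        have := A.σ_alternatingWord_of_adj ⟨hij, hodd⟩
        rwa [← hkm, Nat.add_sub_cancel] at this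
      · left
        have hk' : ¬ Even k := by
          rw [← hkm, Nat.odd_add_one, not_not] at hodd
          simpa using hodd
        have h5 := dihedralCoeff_self h2
        have h6 := dihedralCoeff_pred (k := k) h0
        rw [hkm] at h6
        rw [if_neg hk', hkm, h5, h6] at hv
        simpa using hv
    · right; right
      have g1 := dihedralCoeff_pos h2 k.succ_pos (by omega : k + 1 < A.m i j)
      split_ifs at hv
      · exact ⟨_, _, g1, mul_pos g2 hb, hv⟩
      · exact ⟨_, _, g2, mul_pos g1 hb, hv⟩

/-! ### Positivity of roots, and which multiples of simple roots are roots. -/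

/-- A decomposition of `w` that is compatible with its action on the simple root `αᵢ`. -/
theorem exists_factorization {w : A.W} {i j : ι} (hi : ¬ A.coxeterSystem.IsRightDescent w i)
    (hj : A.coxeterSystem.IsRightDescent w j) :
    ∃ u : A.W, A.coxeterSystem.length u < A.coxeterSystem.length w ∧ ¬ A.coxeterSystem.IsRightDescent u i ∧ ¬ A.coxeterSystem.IsRightDescent u j ∧
      (A.σ w (A.simpleRoot i) = A.σ u (A.simpleRoot i) ∨
        (A.oddGraph.Adj i j ∧ A.σ w (A.simpleRoot i) = A.K j i • A.σ u (A.simpleRoot j)) ∨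
        ∃ p q : ℝ, 0 < p ∧ 0 < q ∧
          A.σ w (A.simpleRoot i) = p • A.σ u (A.simpleRoot i) + q • A.σ u (A.simpleRoot j)) := by
  have hij : i ≠ j := fun h => hi (h ▸ hj)
  obtain ⟨u, k, hw, hk, h1, h2, h3⟩ := CoxeterSystem.exists_eq_mul_alternatingWord A.coxeterSystem w i j hi
  have h0 := h3 hj
  have hlt := CoxeterSystem.lt_of_not_isRightDescent_mul_alternatingWord A.coxeterSystem hw hk hi
  rw [A.coxeterMatrix_apply hij] at hlt
  refine ⟨u, by omega, h1, h2, ?_⟩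
  have hwi : A.σ w (A.simpleRoot i) = _ := (congrArg (A.σ · (A.simpleRoot i)) hw).trans
    (A.σ_mul_apply _ _ _)
  rw [hwi]
  rcases A.σ_alternatingWord_cases hij h0 hlt with h | ⟨ha, h⟩ | ⟨p, q, hp, hq, h⟩
  · exact .inl (by rw [h])
  · exact .inr (.inl ⟨ha, by rw [h, map_smul]⟩)
  · exact .inr (.inr ⟨p, q, hp, hq, by rw [h, map_add, map_smul, map_smul]⟩)

/-- Induction on length: in each case of `exists_factorization` the image is a nonnegative
combination of images under a shorter `u` having neither `i` nor `j` as a right descent. -/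
theorem σ_simpleRoot_nonneg {w : A.W} {i : ι} (hi : ¬ A.coxeterSystem.IsRightDescent w i) :
    0 ≤ A.σ w (A.simpleRoot i) := by
  induction hn : A.coxeterSystem.length w using Nat.strong_induction_on generalizing w i with
  | _ n ih =>
    by_cases hw : w = 1
    · subst hw
      rw [map_one]
      exact Pi.single_nonneg.mpr zero_le_one
    obtain ⟨j, hj⟩ := CoxeterSystem.exists_rightDescent_of_ne_one A.coxeterSystem hw
    obtain ⟨u, hu, h1, h2, h⟩ := A.exists_factorization hi hj
    have n1 := ih _ (hn ▸ hu) h1 rfl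
    have n2 := ih _ (hn ▸ hu) h2 rfl
    rcases h with h | ⟨ha, h⟩ | ⟨p, q, hp, hq, h⟩ <;> rw [h]
    · exact n1
    · exact smul_nonneg (A.K_pos ha).le n2
    · exact add_nonneg (smul_nonneg hp.le n1) (smul_nonneg hq.le n2)

theorem σ_simpleRoot_nonpos {w : A.W} {i : ι} (hi : A.coxeterSystem.IsRightDescent w i) :
    A.σ w (A.simpleRoot i) ≤ 0 := by
  have h := A.σ_simpleRoot_nonneg
    (A.coxeterSystem.isRightDescent_iff_not_isRightDescent_mul.mp hi)
  have e := A.σ_mul_simple_self w i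
  rw [show A.coxeterMatrix.simple i = A.coxeterSystem.simple i from rfl] at e
  rw [e] at h
  exact neg_nonneg.mp h

/-- A positive combination of two different simple roots is not mapped to a multiple of a simple
root if the images of both are nonnegative. -/
theorem add_smul_ne_smul_simpleRoot {u : A.W} {i j x : ι} (hij : i ≠ j) {p q K : ℝ}
    (hp : 0 < p) (hq : 0 < q) (hi : 0 ≤ A.σ u (A.simpleRoot i))
    (hj : 0 ≤ A.σ u (A.simpleRoot j)) :
    p • A.σ u (A.simpleRoot i) + q • A.σ u (A.simpleRoot j) ≠ K • A.simpleRoot x := by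
  intro h
  -- Nonnegative terms cannot cancel, so both images lie on the line of `αₓ`, against the
  -- injectivity of `σ u`.
  have hz : ∀ l ≠ x, A.σ u (A.simpleRoot i) l = 0 ∧ A.σ u (A.simpleRoot j) l = 0 := by
    intro l hl
    have e := congrFun h l
    have hx : A.simpleRoot x l = 0 := Pi.single_eq_of_ne hl 1
    simp only [Pi.add_apply, Pi.smul_apply, smul_eq_mul, hx, mul_zero] at e
    have h1 := mul_nonneg hp.le (hi l)
    have h2 := mul_nonneg hq.le (hj l)
    constructor
    · exact (mul_eq_zero.mp (le_antisymm (by linarith) h1)).resolve_left hp.ne'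
    · exact (mul_eq_zero.mp (le_antisymm (by linarith) h2)).resolve_left hq.ne'
  have e1 := A.eq_smul_simpleRoot fun l hl => (hz l hl).1
  have e2 := A.eq_smul_simpleRoot fun l hl => (hz l hl).2
  generalize A.σ u (A.simpleRoot i) x = c at e1
  generalize A.σ u (A.simpleRoot j) x = d at e2
  have e3 : A.σ u (d • A.simpleRoot i) = A.σ u (c • A.simpleRoot j) := by
    rw [map_smul, map_smul, e1, e2, smul_comm]
  have e4 := congrFun ((A.σ u).injective e3) j
  simp only [Pi.smul_apply, simpleRoot, Pi.single_eq_same, Pi.single_eq_of_ne hij.symm, smul_eq_mul,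
    mul_zero, mul_one] at e4
  rw [← e4, zero_smul] at e1
  exact A.simpleRoot_ne_zero i ((A.σ u).map_eq_zero_iff.mp e1)

/-- Positivity of `K` rules out `y` as a right descent, so `w` can be shortened. An odd edge becomes
the first step of the path and contributes its factor of `K`; a mixed positive combination is
impossible by `add_smul_ne_smul_simpleRoot`. -/
theorem exists_path_of_σ_eq {w : A.W} {y x : ι} {K : ℝ} (hK : 0 < K)
    (h : A.σ w (A.simpleRoot y) = K • A.simpleRoot x) :
    ∃ P : A.ONPath y x, A.scalar P = K := by
  induction hn : A.coxeterSystem.length w using Nat.strong_induction_on generalizing w y K with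
  | _ n ih =>
    by_cases hw : w = 1
    · subst hw
      rw [map_one] at h
      have h : A.simpleRoot y = K • A.simpleRoot x := h
      have hxy : y = x := by
        by_contra hne
        have := congrFun h y
        simp [simpleRoot, hne] at this
      subst hxy
      have := congrFun h y
      simp only [simpleRoot, Pi.single_eq_same, Pi.smul_apply, smul_eq_mul, mul_one] at this
      exact ⟨.nil, this⟩
    have hy : ¬ A.coxeterSystem.IsRightDescent w y := by
      intro hy
      have := A.σ_simpleRoot_nonpos hy x
      rw [h] at this
      simp only [simpleRoot, Pi.single_eq_same, Pi.smul_apply, smul_eq_mul, mul_one,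
        Pi.zero_apply] at this
      linarith
    obtain ⟨j, hj⟩ := CoxeterSystem.exists_rightDescent_of_ne_one A.coxeterSystem hw
    obtain ⟨u, hu, h1, h2, hc⟩ := A.exists_factorization hy hj
    rcases hc with hc | ⟨ha, hc⟩ | ⟨p, q, hp, hq, hc⟩
    · exact ih _ (hn ▸ hu) hK (hc ▸ h) rfl
    · have hpos := A.K_pos ha
      obtain ⟨P, hP⟩ := ih _ (hn ▸ hu) (div_pos hK hpos) (w := u) (y := j)
        (K := K / A.K j y) (by
          rw [div_eq_inv_mul, mul_smul, ← h, hc, inv_smul_smul₀ hpos.ne']) rfl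
      exact ⟨.cons ha P, by rw [scalar, hP, div_mul_cancel₀ _ hpos.ne']⟩
    · exact absurd (hc.symm.trans h) (A.add_smul_ne_smul_simpleRoot (by rintro rfl; exact hy hj) hp hq
        (A.σ_simpleRoot_nonneg h1) (A.σ_simpleRoot_nonneg h2))

theorem exists_σ_eq_of_path {y x : ι} (P : A.ONPath y x) :
    ∃ w : A.W, A.σ w (A.simpleRoot y) = A.scalar P • A.simpleRoot x := by
  induction P with
  | nil => exact ⟨1, by simp [scalar]⟩
  | @cons i j _ h P ih =>
    obtain ⟨w, hw⟩ := ih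
    refine ⟨w * A.coxeterSystem.wordProd (CoxeterSystem.alternatingWord i j (A.m i j - 1)), ?_⟩
    rw [σ_mul_apply, A.σ_alternatingWord_of_adj h, map_smul, hw, smul_smul, scalar, mul_comm]

end Fintype

end EGCM

/-! ### The set of scalars of the paths ending at a node. -/

namespace EGCM

variable {ι : Type*} (A : EGCM ι)

/-- The scalars of the ON-paths with end node `x`. -/
def pathScalars (x : ι) : Set ℝ := {r | ∃ (z : ι) (P : A.ONPath z x), A.scalar P = r}

theorem encard_pathScalars_eq {x y : ι} (Q : A.ONPath x y) :
    (A.pathScalars x).encard = (A.pathScalars y).encard := by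
  have hQ := A.scalar_reverse Q
  -- Extending paths by `Q` multiplies scalars by `A.scalar Q`; extending by its reverse undoes
  -- this.
  have h : A.pathScalars y = (A.scalar Q * ·) '' A.pathScalars x := by
    ext r
    constructor
    · rintro ⟨z, P, rfl⟩
      refine ⟨_, ⟨z, P.append Q.reverse, rfl⟩, ?_⟩
      change A.scalar Q * A.scalar (P.append Q.reverse) = _
      rw [scalar_append]
      linear_combination A.scalar P * hQ
    · rintro ⟨_, ⟨z, P, rfl⟩, rfl⟩
      exact ⟨z, P.append Q, A.scalar_append P Q⟩
  rw [h, (mul_right_injective₀ (A.scalar_pos Q).ne').encard_image]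

theorem scalar_eq_of_unital {z x : ι} (h : ∀ C : A.ONPath z z, A.scalar C = 1)
    (P Q : A.ONPath z x) : A.scalar P = A.scalar Q := by
  have h1 := h (P.append Q.reverse)
  have h2 := A.scalar_reverse Q
  rw [scalar_append] at h1
  exact mul_left_cancel₀ (A.scalar_pos Q.reverse).ne' (h1.trans h2.symm)

/-- Each start node contributes at most one scalar. -/
theorem finite_pathScalars [Finite ι] {x : ι}
    (h : ∀ z, Nonempty (A.ONPath z x) → ∀ C : A.ONPath z z, A.scalar C = 1) :
    (A.pathScalars x).Finite := by
  have e : A.pathScalars x = ⋃ z, {r | ∃ P : A.ONPath z x, A.scalar P = r} := by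
    ext r
    simp [pathScalars]
  rw [e]
  refine Set.finite_iUnion fun z => Set.Subsingleton.finite ?_
  rintro _ ⟨P, rfl⟩ _ ⟨Q, rfl⟩
  exact A.scalar_eq_of_unital (h z ⟨P⟩) P Q

theorem scalar_eq_one_of_finite {x : ι} (h : (A.pathScalars x).Finite) (C : A.ONPath x x) :
    A.scalar C = 1 := by
  by_contra hC
  -- The powers of a positive number other than `1` are distinct, and each is the scalar of an
  -- iterate of `C`.
  refine Set.infinite_of_injective_forall_mem
    (pow_right_injective₀ (A.scalar_pos C) hC) (fun n => ?_) h
  induction n with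
  | zero => exact ⟨x, .nil, by simp [scalar]⟩
  | succ n ih =>
    obtain ⟨z, P, hP⟩ := ih
    exact ⟨z, P.append C, by rw [scalar_append, hP, pow_succ']⟩

theorem isSimple_of_isPath {x y : ι} {P : A.ONPath x y} (hP : P.IsPath) : A.IsSimple P := by
  intro r s hrs hs h
  have := hP.getVert_injOn (by simpa using hrs.le.trans hs) (by simpa using hs) h
  omega

theorem isGreatest_hasScalarDistinctPaths {x : ι} (hfin : (A.pathScalars x).Finite)
    (h : ∀ z, Nonempty (A.ONPath z x) → ∀ C : A.ONPath z z, A.scalar C = 1) :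
    IsGreatest {k : ℕ | A.HasScalarDistinctPaths x k} (A.pathScalars x).ncard := by
  classical
  constructor
  · have hex : ∀ r : A.pathScalars x, ∃ P : Σ z : ι, A.ONPath z x,
        A.IsSimple P.2 ∧ A.scalar P.2 = r := by
      rintro ⟨r, z, P, rfl⟩
      -- Removing the loops of `P` keeps its endpoints, hence its scalar.
      exact ⟨⟨z, P.bypass⟩, A.isSimple_of_isPath P.bypass_isPath,
        A.scalar_eq_of_unital (h z ⟨P⟩) _ _⟩
    choose f hf1 hf2 using hex
    have hinj : Function.Injective f := fun r s hrs => by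
      rw [Subtype.ext_iff, ← hf2 r, ← hf2 s, hrs]
    have := hfin.fintype
    refine ⟨Finset.univ.image f, ?_, ?_, ?_⟩
    · rw [Finset.card_image_of_injective _ hinj, Finset.card_univ, ← Nat.card_eq_fintype_card,
        Nat.card_coe_set_eq]
    · simp only [Finset.mem_image, Finset.mem_univ, true_and]
      rintro _ ⟨r, rfl⟩
      exact hf1 r
    · simp only [Finset.mem_image, Finset.mem_univ, true_and]
      rintro _ ⟨r, rfl⟩ _ ⟨s, rfl⟩ hne
      rw [hf2, hf2]
      exact fun e => hne (congrArg f (Subtype.ext e))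
  · rintro k ⟨F, rfl, -, hF⟩
    have hinj : Set.InjOn (fun P : Σ z : ι, A.ONPath z x => A.scalar P.2) F := by
      intro P hP Q hQ e
      by_contra hne
      exact hF P hP Q hQ hne e
    rw [← Set.ncard_coe_finset, ← hinj.ncard_image]
    refine Set.ncard_le_ncard ?_ hfin
    rintro _ ⟨P, -, rfl⟩
    exact ⟨P.1, P.2, rfl⟩

/-! ### Passing between an ON-component and the whole graph. -/

section Component

variable {A} {J : Set ι}

theorem IsONComponent.mem_of_path (hJ : A.IsONComponent J) {x y : ι} (hx : x ∈ J)
    (P : A.ONPath x y) : y ∈ J := by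
  have h : ∀ z ∈ insert y J, Nonempty (A.ONPath x z) := by
    rintro z (rfl | hz)
    exacts [⟨P⟩, hJ.prop x hx z hz]
  -- Adjoining `y` keeps the nodes pairwise joined, through `x`, so maximality applies.
  refine hJ.le_of_ge (y := insert y J) (fun u hu v hv => ?_) (Set.subset_insert y J)
    (Set.mem_insert y J)
  obtain ⟨Q⟩ := h u hu
  obtain ⟨R⟩ := h v hv
  exact ⟨Q.reverse.append R⟩

/-- The empty set satisfies the joining condition vacuously; only maximality excludes it. -/
theorem IsONComponent.nonempty [Nonempty ι] (hJ : A.IsONComponent J) : J.Nonempty := by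
  obtain ⟨x⟩ := ‹Nonempty ι›
  by_contra h
  rw [Set.not_nonempty_iff_eq_empty] at h
  subst h
  refine hJ.le_of_ge (y := {x}) ?_ (Set.empty_subset _) (Set.mem_singleton x)
  rintro _ rfl _ rfl
  exact ⟨.nil⟩

theorem exists_path_of_restrict {x y : J} (P : (A.restrict J).ONPath x y) :
    ∃ Q : A.ONPath x y, A.scalar Q = (A.restrict J).scalar P := by
  induction P with
  | nil => exact ⟨.nil, rfl⟩
  | @cons i j _ h P ih =>
    obtain ⟨Q, hQ⟩ := ih
    have h' : A.oddGraph.Adj i j := ⟨Subtype.coe_ne_coe.mpr h.1, h.2⟩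
    exact ⟨.cons h' Q, by rw [scalar, scalar, hQ]; rfl⟩

theorem IsONComponent.exists_path_restrict (hJ : A.IsONComponent J) {x y : ι} (P : A.ONPath x y)
    (hx : x ∈ J) (hy : y ∈ J) :
    ∃ Q : (A.restrict J).ONPath ⟨x, hx⟩ ⟨y, hy⟩, (A.restrict J).scalar Q = A.scalar P := by
  induction P with
  | nil => exact ⟨.nil, rfl⟩
  | @cons i j _ h P ih =>
    have hj : j ∈ J := hJ.mem_of_path hx (.cons h .nil)
    obtain ⟨Q, hQ⟩ := ih hj hy
    have h' : (A.restrict J).oddGraph.Adj ⟨i, hx⟩ ⟨j, hj⟩ :=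
      ⟨fun e => h.1 (congrArg Subtype.val e), h.2⟩
    exact ⟨.cons h' Q, by rw [scalar, scalar, hQ]; rfl⟩

theorem IsONComponent.unitalONCyclic_restrict_iff (hJ : A.IsONComponent J) :
    (A.restrict J).UnitalONCyclic ↔ ∀ x ∈ J, ∀ C : A.ONPath x x, A.scalar C = 1 := by
  constructor
  · intro h x hx C
    obtain ⟨Q, hQ⟩ := hJ.exists_path_restrict C hx hx
    rw [← hQ, h]
  · intro h x C
    obtain ⟨Q, hQ⟩ := exists_path_of_restrict C
    rw [← hQ, h _ x.2]

end Component

/-! ### Counting the positive multiples of a root. -/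

section Fintype

variable [Fintype ι] [DecidableEq ι]

theorem σ_mem_roots_iff (w : A.W) {v : ι → ℝ} : A.σ w v ∈ A.roots ↔ v ∈ A.roots := by
  constructor
  · rintro ⟨u, i, h⟩
    refine ⟨w⁻¹ * u, i, ?_⟩
    rw [σ_mul_apply, ← h, ← σ_mul_apply, inv_mul_cancel, map_one]
    rfl
  · rintro ⟨u, i, rfl⟩
    exact ⟨w * u, i, (A.σ_mul_apply w u _).symm⟩

theorem smul_simpleRoot_mem_roots_iff {K : ℝ} (hK : 0 < K) (x : ι) :
    K • A.simpleRoot x ∈ A.roots ↔ K ∈ A.pathScalars x := by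
  constructor
  · rintro ⟨w, y, h⟩
    exact ⟨y, A.exists_path_of_σ_eq hK h.symm⟩
  · rintro ⟨y, P, rfl⟩
    obtain ⟨w, hw⟩ := A.exists_σ_eq_of_path P
    exact ⟨w, y, hw.symm⟩

theorem σ_simpleRoot_ne_zero (w : A.W) (x : ι) : A.σ w (A.simpleRoot x) ≠ 0 :=
  (A.σ w).map_ne_zero_iff.mpr (A.simpleRoot_ne_zero x)

theorem multiples_neg (v : ι → ℝ) : A.multiples (-v) = A.multiples v := by
  have : {u : ι → ℝ | ∃ K : ℝ, u = K • -v} = {u | ∃ K : ℝ, u = K • v} := by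
    ext u
    constructor <;> rintro ⟨K, rfl⟩ <;> exact ⟨-K, by simp⟩
  rw [multiples, multiples, this]

/-- Applying `w⁻¹` reduces the question to multiples of `αₓ`. As the root is nonnegative and roots
are nonzero, the positive multiples are those with `K > 0`. -/
theorem multiples_σ_simpleRoot {w : A.W} {x : ι}
    (hx : ¬ A.coxeterSystem.IsRightDescent w x) :
    A.multiples (A.σ w (A.simpleRoot x)) =
      (fun K : ℝ => K • A.σ w (A.simpleRoot x)) '' A.pathScalars x := by
  have hnn := A.σ_simpleRoot_nonneg hx
  have hne := A.σ_simpleRoot_ne_zero w x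
  ext v
  constructor
  · rintro ⟨⟨K, rfl⟩, hroot, hv⟩
    rw [← map_smul, σ_mem_roots_iff] at hroot
    refine ⟨K, (A.smul_simpleRoot_mem_roots_iff ?_ x).mp hroot, rfl⟩
    obtain ⟨l, hl⟩ := Function.ne_iff.mp hne
    have hl : 0 < A.σ w (A.simpleRoot x) l := lt_of_le_of_ne (hnn l) (Ne.symm hl)
    refine lt_of_le_of_ne (nonneg_of_mul_nonneg_left (hv l) hl) ?_
    rintro rfl
    obtain ⟨u, i, h⟩ := hroot
    rw [zero_smul] at h
    exact A.σ_simpleRoot_ne_zero u i h.symm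
  · rintro ⟨K, hK, rfl⟩
    have hpos : 0 < K := by
      obtain ⟨z, P, rfl⟩ := hK
      exact A.scalar_pos P
    refine ⟨⟨K, rfl⟩, ?_, fun l => mul_nonneg hpos.le (hnn l)⟩
    change K • A.σ w (A.simpleRoot x) ∈ A.roots
    rw [← map_smul, σ_mem_roots_iff]
    exact (A.smul_simpleRoot_mem_roots_iff hpos x).mpr hK

theorem encard_multiples (w : A.W) (x : ι) :
    (A.multiples (A.σ w (A.simpleRoot x))).encard = (A.pathScalars x).encard := by
  by_cases hx : A.coxeterSystem.IsRightDescent w x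
  -- Replacing `w` by `w sₓ` negates the root, which spans the same line, and removes the descent.
  · have h := A.coxeterSystem.isRightDescent_iff_not_isRightDescent_mul.mp hx
    have e : A.σ (w * A.coxeterSystem.simple x) (A.simpleRoot x) = _ := A.σ_mul_simple_self w x
    rw [← multiples_neg, ← e, A.multiples_σ_simpleRoot h,
      (smul_left_injective ℝ (A.σ_simpleRoot_ne_zero _ x)).encard_image]
  · rw [A.multiples_σ_simpleRoot hx,
      (smul_left_injective ℝ (A.σ_simpleRoot_ne_zero _ x)).encard_image]

end Fintype

end EGCM

theorem theorem3p6 {ι : Type*} [Fintype ι] [DecidableEq ι] [Nonempty ι] (A : EGCM ι)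
    (J : Set ι) (hJ : A.IsONComponent J) :
    List.TFAE [
      (A.restrict J).UnitalONCyclic,
      ∃ x ∈ J, ∃ w : A.W, (A.multiples (A.σ w (A.simpleRoot x))).Finite,
      ∀ x ∈ J, ∀ w : A.W, (A.multiples (A.σ w (A.simpleRoot x))).Finite] ∧
    ((A.restrict J).UnitalONCyclic →
      ∀ x ∈ J,
        (∀ y ∈ J, ∀ w : A.W,
          (A.multiples (A.simpleRoot x)).encard =
            (A.multiples (A.σ w (A.simpleRoot y))).encard) ∧
        ∃ N : ℕ, IsGreatest {k : ℕ | A.HasScalarDistinctPaths x k} N ∧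
          (A.multiples (A.simpleRoot x)).encard = N) := by
  have hfin : ∀ x (w : A.W), (A.multiples (A.σ w (A.simpleRoot x))).Finite ↔
      (A.pathScalars x).Finite := fun x w => by
    rw [← Set.encard_lt_top_iff, ← Set.encard_lt_top_iff, A.encard_multiples]
  have hconst : ∀ x ∈ J, ∀ y ∈ J, (A.pathScalars x).encard = (A.pathScalars y).encard :=
    fun x hx y hy => (hJ.prop x hx y hy).elim A.encard_pathScalars_eq
  have hunital : (A.restrict J).UnitalONCyclic → ∀ x ∈ J, ∀ z, Nonempty (A.ONPath z x) →
      ∀ C : A.ONPath z z, A.scalar C = 1 := fun h x hx z ⟨P⟩ =>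
    hJ.unitalONCyclic_restrict_iff.mp h z (hJ.mem_of_path hx P.reverse)
  have hone : ∀ x, (A.multiples (A.simpleRoot x)).encard = (A.pathScalars x).encard := fun x => by
    have := A.encard_multiples 1 x
    rwa [map_one] at this
  refine ⟨?_, fun h x hx => ⟨fun y hy w => ?_, (A.pathScalars x).ncard, ?_, ?_⟩⟩
  · simp only [hfin]
    tfae_have 1 → 3 := fun h x hx _ => A.finite_pathScalars (hunital h x hx)
    tfae_have 3 → 2 := fun h => by
      obtain ⟨x, hx⟩ := hJ.nonempty
      exact ⟨x, hx, 1, h x hx 1⟩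
    tfae_have 2 → 1 := by
      rintro ⟨x, hx, -, h⟩
      -- Finiteness at one node spreads over the component, because all its nodes have equally many
      -- path scalars.
      refine hJ.unitalONCyclic_restrict_iff.mpr fun y hy => A.scalar_eq_one_of_finite ?_
      rwa [← Set.encard_lt_top_iff, hconst y hy x hx, Set.encard_lt_top_iff]
    tfae_finish
  · rw [hone, A.encard_multiples, hconst x hx y hy]
  · exact A.isGreatest_hasScalarDistinctPaths (A.finite_pathScalars (hunital h x hx))
      (hunital h x hx)
  · rw [hone, (A.finite_pathScalars (hunital h x hx)).cast_ncard_eq]
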